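/- Let $\mu<\kappa<\lambda$ be infinite cardinals with $\mu$ and $\kappa$ regular. For cardinals $\chi$ and $\sigma$ let $P_\chi(\sigma)=\{a\subseteq\sigma:|a|<\chi\}$, and let $u(\kappa,\sigma)$ denote the least cardinality of a cofinal subset of the poset $(P_\kappa(\sigma),\subseteq)$. A $\mu$-club of $P_\kappa(\sigma)$ is a cofinal subset $C$ of $(P_\kappa(\sigma),\subseteq)$ such that $\bigcup_{i<\mu}a_i\in C$ for every strictly $\subset$-increasing sequence $\langle a_i:i<\mu\rangle$ of members of $C$; and $N\mu\text{-}S_{\kappa,\sigma}$ denotes the collection of all $B\subseteq P_\kappa(\sigma)$ that are disjoint from some $\mu$-club of $P_\kappa(\sigma)$. Let $NS_{\lambda^+}$ be the collection of all nonstationary subsets of $\lambda^+$, let $E^{\lambda^+}_\mu$ be the set of all limit ordinals $\alpha<\lambda^+$ with $\mathrm{cf}(\alpha)=\mu$, and let $NS_{\lambda^+}|E^{\lambda^+}_\mu=\{B\subseteq\lambda^+: B\cap E^{\lambda^+}_\mu\in NS_{\lambda^+}\}$. Finally let $$\mathrm{Sup}(N\mu\text{-}S_{\kappa,\lambda^+})=\{B\subseteq\lambda^+:\{x\in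 P_\kappa(\lambda^+):\sup x\in B\}\in N\mu\text{-}S_{\kappa,\lambda^+}\}.$$ **Proposition 4.9.** Suppose that $\mathrm{cf}(\lambda)=\mu$, and that $u(\kappa,\sigma)<\lambda$ for every cardinal $\sigma$ with $\kappa\le\sigma<\lambda$. Then $$\mathrm{Sup}(N\mu\text{-}S_{\kappa,\lambda^+})\subseteq NS_{\lambda^+}|E^{\lambda^+}_\mu .$$ That is, for every stationary set $S\subseteq\lambda^+$ with $S\subseteq E^{\lambda^+}_\mu$, the set $\{x\in P_\kappa(\lambda^+):\sup x\in S\}$ does not belong to $N\mu\text{-}S_{\kappa,\lambda^+}$. -/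

import Mathlib

open Set Order
open scoped Cardinal Ordinal

universe u

/-- `P_χ(A)`, the collection of all subsets of `A` of cardinality less than `χ`,
for a set `A` of ordinals. A cardinal `σ` is identified with the set `Set.Iio σ.ord` of
the ordinals below its initial ordinal. -/
def Pk (χ : Cardinal.{u}) (A : Set Ordinal.{u}) : Set (Set Ordinal.{u}) :=
  {a | a ⊆ A ∧ #a < Cardinal.lift.{u + 1} χ}

/-- `u(χ, σ)`, the least cardinality of a cofinal subset of the poset `(P_χ(σ), ⊆)`. -/
noncomputable def uNum (χ σ : Cardinal.{u}) : Cardinal.{u + 1} :=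
  Order.cof (Pk χ (Iio σ.ord))

/-- `A` is `ν`-closed: it contains the union of every strictly `⊂`-increasing sequence of length
`ν` of members of `A`. -/
def NuClosed (ν : Cardinal.{u}) (A : Set (Set Ordinal.{u})) : Prop :=
  ∀ a : Iio ν.ord → Set Ordinal.{u}, StrictMono a → (∀ i, a i ∈ A) → (⋃ i, a i) ∈ A

/-- `C` is a `ν`-club of `P_χ(σ)`: a `ν`-closed, cofinal subset of `P_χ(σ)`. -/
structure IsNuClub (ν χ σ : Cardinal.{u}) (C : Set (Set Ordinal.{u})) : Prop where
  subset : C ⊆ Pk χ (Iio σ.ord)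
  closed : NuClosed ν C
  cofinal : ∀ a ∈ Pk χ (Iio σ.ord), ∃ c ∈ C, a ⊆ c

/-- `Nν-S_{χ,σ}`, the collection of all subsets of `P_χ(σ)` that are disjoint from some `ν`-club
of `P_χ(σ)`. -/
def NNuS (ν χ σ : Cardinal.{u}) : Set (Set (Set Ordinal.{u})) :=
  {B | B ⊆ Pk χ (Iio σ.ord) ∧ ∃ C, IsNuClub ν χ σ C ∧ B ∩ C = ∅}

/-- `NS_χ`, the collection of all nonstationary subsets of `χ`. -/
def NSIdeal (χ : Cardinal.{u}) : Set (Set Ordinal.{u}) :=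
  {A | A ⊆ Iio χ.ord ∧ ¬ IsStationary {α : Iio χ.ord | (α : Ordinal.{u}) ∈ A}}

/-- `E_ν^χ`, the set of all limit ordinals `α < χ` of cofinality `ν`. -/
def ECof (ν χ : Cardinal.{u}) : Set Ordinal.{u} :=
  {α | α < χ.ord ∧ IsSuccLimit α ∧ α.cof = ν}

/-- `J|A = {B ⊆ X : B ∩ A ∈ J}`, for a collection `J` of subsets of `X`. -/
def restrictTo {T : Type*} (X : Set T) (J : Set (Set T)) (A : Set T) : Set (Set T) :=
  {B | B ⊆ X ∧ B ∩ A ∈ J}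

/-- `f(J) = {B ⊆ Y : f⁻¹(B) ∈ J}`, for a collection `J` of subsets of `X` and `f : X → Y`. -/
def pushTo {T T' : Type*} (X : Set T) (Y : Set T') (f : T → T') (J : Set (Set T)) :
    Set (Set T') :=
  {B | B ⊆ Y ∧ {x ∈ X | f x ∈ B} ∈ J}

/-- `Sup(J)`, for a collection `J` of subsets of `P_χ(σ)`, where `Sup : P_χ(σ) → σ` is the map
`a ↦ sup a`. This is used for regular `σ > χ`, where `sup a < σ` for every `a ∈ P_χ(σ)`. -/
noncomputable def SupIdeal (χ σ : Cardinal.{u}) (J : Set (Set (Set Ordinal.{u}))) :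
    Set (Set Ordinal.{u}) :=
  pushTo (Pk χ (Iio σ.ord)) (Iio σ.ord) (fun a => sSup a) J

/-! Given a `μ`-club `C`, it suffices that club many `α < λ⁺`, when of cofinality `μ`, are suprema
of members of `C`. A set of fewer than `μ = cf λ` ordinals below `λ` is bounded, so the hypothesis
on `u(κ, σ)` yields `λ` many small sets covering all of these. Injections `γ → λ` carry this to
small sets `e ξ ⊆ ξ`, `ξ < λ⁺`. By recursion choose `x ξ ∈ C` containing `ξ` and every `x η` with `η
∈ e ξ`. If `α` is a suitable closure point of cofinality `μ`, some cofinal `⟨s i : i < μ⟩` in `α`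
has all earlier `s j` in `e (s i)`. The `x (s i)` then strictly increase, so their union lies in
`C`, and its supremum is `α`. -/

/-- If `λ` has cofinality `μ < κ < λ` and `u(κ, σ) < λ` for all cardinals `σ ∈ [κ, λ)`, there is a
family of `λ` members of `P_κ(λ)` covering every subset of `λ` of size less than `μ`. -/
theorem exists_covering_family {μ κ lam : Cardinal.{u}} (hκ : κ.IsRegular)
    (hμκ : μ < κ) (hκlam : κ < lam) (hcof : lam.ord.cof = μ)
    (hu : ∀ σ : Cardinal.{u}, κ ≤ σ → σ < lam → uNum κ σ < Cardinal.lift.{u + 1} lam) :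
    ∃ G : Ordinal.{u} → Set Ordinal.{u}, (∀ ζ, #(G ζ) < Cardinal.lift.{u + 1} κ) ∧
      ∀ b ⊆ Iio lam.ord, #b < Cardinal.lift.{u + 1} μ → ∃ ζ < lam.ord, b ⊆ G ζ := by
  have hlam : ℵ₀ ≤ lam := hκ.aleph0_le.trans hκlam.le
  have hsing : lam.IsSingular := ⟨hlam, by rw [hcof]; exact (hμκ.trans hκlam).ne⟩
  -- The maximum with `κ` puts `σ τ` in the range of `hu`; the successor gives `τ < (σ τ).ord`.
  let σ : Ordinal.{u} → Cardinal.{u} := fun τ => max κ (succ τ.card)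
  have hσ : ∀ τ < lam.ord, σ τ < lam := fun τ hτ =>
    max_lt hκlam (hsing.isSuccLimit.succ_lt (Cardinal.lt_ord.1 hτ))
  have hS : ∀ τ, ∃ s : Set (Pk κ (Iio (σ τ).ord)), IsCofinal s ∧ #s = uNum κ (σ τ) :=
    fun τ => Order.exists_cof_eq _
  choose S hScof hScard using hS
  let T : Set (Set Ordinal.{u}) := ⋃ τ : Iio lam.ord, Subtype.val '' S τ
  have hIio : #(Iio lam.ord) = Cardinal.lift.{u + 1} lam := by
    rw [Cardinal.mk_Iio_ordinal, Cardinal.card_ord]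
  have hTcard : #T ≤ #(Iio lam.ord) := by
    refine (Cardinal.mk_iUnion_le _).trans ?_
    rw [hIio]
    refine Cardinal.mul_le_of_le (by simpa using hlam) le_rfl ?_
    refine ciSup_le' fun τ => Cardinal.mk_image_le.trans ?_
    rw [hScard]
    exact (hu _ (le_max_left _ _) (hσ _ τ.2)).le
  obtain ⟨f⟩ := hTcard
  classical
  have hκ0 : (0 : Cardinal.{u + 1}) < Cardinal.lift.{u + 1} κ := by
    simpa using hκ.pos
  -- `G` inverts the injection `f : T → λ`, with `∅` off its range.
  refine ⟨fun ζ => if h : ∃ t : T, (f t : Ordinal) = ζ then h.choose else ∅, fun ζ => ?_,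
    fun b hb hbμ => ?_⟩
  · dsimp only
    split_ifs with h
    · obtain ⟨τ, hτ⟩ := mem_iUnion.1 h.choose.2
      obtain ⟨s, -, hs⟩ := hτ
      rw [← hs]
      exact s.2.2
    · simpa using hκ0
  · let τ := sSup ((· + 1) '' b)
    have hτ : τ < lam.ord := by
      refine Ordinal.sSup_add_one_lt_of_lt_cof ?_ hb
      rwa [← Ordinal.lift_cof, hcof]
    have hbτ : b ⊆ Iio (σ τ).ord := fun η hη => by
      have h1 : η < τ := (lt_add_one η).trans_le
        (le_csSup ⟨lam.ord + 1, by rintro _ ⟨y, hy, rfl⟩; exact add_le_add_left (hb hy).le 1⟩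
          (mem_image_of_mem _ hη))
      refine h1.trans ((Cardinal.lt_ord_succ_card τ).trans_le ?_)
      exact Cardinal.ord_le_ord.2 (le_max_right _ _)
    obtain ⟨s, hs, hbs⟩ := hScof τ ⟨b, hbτ, hbμ.trans (Cardinal.lift_lt.2 hμκ)⟩
    let t : T := ⟨s, mem_iUnion.2 ⟨⟨τ, hτ⟩, mem_image_of_mem _ hs⟩⟩
    refine ⟨f t, (f t).2, ?_⟩
    have h : ∃ t' : T, (f t' : Ordinal) = f t := ⟨t, rfl⟩
    have ht : h.choose = t := f.injective (Subtype.ext h.choose_spec)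
    simp only [dif_pos h, ht]
    exact hbs

/-- An enumeration of small subsets of `λ⁺`, such that for each `γ < λ⁺` all subsets of `γ` of size
less than `μ` are covered by sets with index in the interval `[γ, λ(γ + 1))`. -/
theorem exists_covering_sequence {μ κ lam : Cardinal.{u}} (hκ : κ.IsRegular)
    (hμκ : μ < κ) (hκlam : κ < lam) (hcof : lam.ord.cof = μ)
    (hu : ∀ σ : Cardinal.{u}, κ ≤ σ → σ < lam → uNum κ σ < Cardinal.lift.{u + 1} lam) :
    ∃ e : Ordinal.{u} → Set Ordinal.{u}, (∀ ξ, e ξ ⊆ Iio ξ) ∧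
      (∀ ξ < (succ lam).ord, #(e ξ) < Cardinal.lift.{u + 1} κ) ∧
      ∀ γ < (succ lam).ord, ∀ b ⊆ Iio γ, #b < Cardinal.lift.{u + 1} μ →
        ∃ ξ, γ ≤ ξ ∧ ξ < lam.ord * (γ + 1) ∧ b ⊆ e ξ := by
  obtain ⟨G, hG, hGb⟩ := exists_covering_family hκ hμκ hκlam hcof hu
  have hlam0 : 0 < lam.ord := by simpa using zero_le.trans_lt hκlam
  have hdivle : ∀ ξ : Ordinal.{u}, ξ / lam.ord ≤ ξ := fun ξ =>
    Ordinal.div_le_of_le_mul (Ordinal.le_mul_right ξ hlam0)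
  have hg : ∀ γ : Ordinal.{u}, ∃ g : Ordinal.{u} → Ordinal.{u}, γ < (succ lam).ord →
      InjOn g (Iio γ) ∧ MapsTo g (Iio γ) (Iio lam.ord) := by
    intro γ
    by_cases hγ : γ < (succ lam).ord
    · have : #(Iio γ) ≤ #(Iio lam.ord) := by
        rw [Cardinal.mk_Iio_ordinal, Cardinal.mk_Iio_ordinal, Cardinal.lift_le, Cardinal.card_ord]
        exact Order.lt_succ_iff.1 (Cardinal.lt_ord.1 hγ)
      obtain ⟨g⟩ := this
      classical
      refine ⟨fun η => if h : η < γ then g ⟨η, h⟩ else 0, fun _ => ⟨?_, ?_⟩⟩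
      · intro a (ha : a < γ) b (hb : b < γ) hab
        simp only [ha, hb, dif_pos] at hab
        exact congrArg Subtype.val (g.injective (Subtype.ext hab))
      · intro a (ha : a < γ)
        simpa only [ha, dif_pos] using! (g ⟨a, ha⟩).2
    · exact ⟨id, fun h => absurd h hγ⟩
  choose g hg using hg
  -- The index `ξ = λ·γ + ζ` codes the pair `(γ, ζ)`, and `e ξ` is the part of `γ` that `g γ` maps
  -- into `G ζ`.
  refine ⟨fun ξ => {η | η < ξ / lam.ord ∧ g (ξ / lam.ord) η ∈ G (ξ % lam.ord)}, ?_, ?_, ?_⟩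
  · exact fun ξ η hη => hη.1.trans_le (hdivle _)
  · intro ξ hξ
    have hinj := (hg (ξ / lam.ord) ((hdivle _).trans_lt hξ)).1
    refine lt_of_le_of_lt ?_ (hG (ξ % lam.ord))
    refine Cardinal.mk_le_of_injective
      (f := fun η => (⟨g (ξ / lam.ord) η.1, η.2.2⟩ : G (ξ % lam.ord))) fun a b hab => ?_
    exact Subtype.ext (hinj a.2.1 b.2.1 (congrArg Subtype.val hab))
  · intro γ hγ b hb hbμ
    obtain ⟨ζ, hζ, hbζ⟩ := hGb (g γ '' b) ((hg γ hγ).2.mono_left hb).image_subset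
      (Cardinal.mk_image_le.trans_lt hbμ)
    refine ⟨lam.ord * γ + ζ, ?_, ?_, fun η hη => ?_⟩
    · exact (Ordinal.le_mul_right γ hlam0).trans (le_add_of_nonneg_right zero_le)
    · rw [mul_add, mul_one]
      exact (add_lt_add_iff_left _).2 hζ
    · have hdiv : (lam.ord * γ + ζ) / lam.ord = γ := by
        rw [Ordinal.mul_add_div _ hlam0.ne', Ordinal.div_eq_zero_of_lt hζ, add_zero]
      have hmod : (lam.ord * γ + ζ) % lam.ord = ζ := by
        rw [Ordinal.mul_add_mod_self, Ordinal.mod_eq_of_lt hζ]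
      simp only [mem_ofPred_eq, hdiv, hmod]
      exact ⟨hb hη, hbζ (mem_image_of_mem _ hη)⟩

/-- Members of a cofinal `C ⊆ P_κ(θ)` can be chosen along `ξ < θ` so that the member at `ξ`
contains `ξ` and all members at indices in a prescribed small set of predecessors of `ξ`. -/
theorem exists_coherent_sequence {κ θ : Cardinal.{u}} (hκ : κ.IsRegular)
    {C : Set (Set Ordinal.{u})} (hsub : C ⊆ Pk κ (Iio θ.ord))
    (hC : ∀ a ∈ Pk κ (Iio θ.ord), ∃ c ∈ C, a ⊆ c) (e : Ordinal.{u} → Set Ordinal.{u})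
    (he : ∀ ξ, e ξ ⊆ Iio ξ) (hecard : ∀ ξ < θ.ord, #(e ξ) < Cardinal.lift.{u + 1} κ) :
    ∃ x : Ordinal.{u} → Set Ordinal.{u}, ∀ ξ < θ.ord,
      x ξ ∈ C ∧ ξ ∈ x ξ ∧ ∀ η ∈ e ξ, x η ⊆ x ξ := by
  have hc : ∀ a : Set Ordinal.{u}, ∃ c, a ∈ Pk κ (Iio θ.ord) → c ∈ C ∧ a ⊆ c := fun a => by
    by_cases ha : a ∈ Pk κ (Iio θ.ord)
    · obtain ⟨c, h⟩ := hC a ha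
      exact ⟨c, fun _ => h⟩
    · exact ⟨∅, fun h => absurd h ha⟩
  choose c hc using hc
  let x : Ordinal.{u} → Set Ordinal.{u} := WellFoundedLT.fix (motive := fun _ => Set Ordinal.{u})
    fun ξ ih => c (insert ξ (⋃ η : e ξ, ih η (he ξ η.2)))
  have hx : ∀ ξ, x ξ = c (insert ξ (⋃ η : e ξ, x η)) := fun ξ => WellFoundedLT.fix_eq _ ξ
  have hκ' : (Cardinal.lift.{u + 1} κ).IsRegular := hκ.lift
  have key : ∀ ξ < θ.ord, insert ξ (⋃ η : e ξ, x η) ∈ Pk κ (Iio θ.ord) := by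
    intro ξ
    induction ξ using WellFoundedLT.induction with
    | ind ξ ih =>
      intro hξ
      have hmem : ∀ η : e ξ, x η ∈ Pk κ (Iio θ.ord) := fun η => by
        rw [hx]
        exact hsub (hc _ (ih η (he ξ η.2) ((he ξ η.2).trans hξ))).1
      refine ⟨insert_subset hξ (iUnion_subset fun η => (hmem η).1), ?_⟩
      refine Cardinal.mk_insert_le.trans_lt ?_
      refine Cardinal.add_lt_of_lt hκ'.aleph0_le ?_
        (Cardinal.one_lt_aleph0.trans_le hκ'.aleph0_le)
      rw [Cardinal.card_iUnion_lt_iff_forall_of_isRegular hκ' (hecard ξ hξ)]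
      exact fun η => (hmem η).2
  refine ⟨x, fun ξ hξ => ?_⟩
  obtain ⟨h1, h2⟩ := hc _ (key ξ hξ)
  rw [← hx] at h1 h2
  exact ⟨h1, h2 (mem_insert _ _), fun η hη => (subset_iUnion (fun η : e ξ => x η) ⟨η, hη⟩).trans
    ((subset_insert _ _).trans h2)⟩

/-- The closure points of a function on a regular uncountable cardinal form a club. -/
theorem isClub_closurePoints {c : Cardinal.{u}} (hc : c.IsRegular) (hc' : ℵ₀ < c)
    {f : Ordinal.{u} → Ordinal.{u}} (hf : ∀ ξ < c.ord, f ξ < c.ord) :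
    IsClub {α : Iio c.ord | ∀ ξ < (α : Ordinal.{u}), f ξ < α} := by
  refine ⟨fun d hd _ _ a ha ξ hξ => ?_, fun a => ?_⟩
  · obtain ⟨b, hb, hξb⟩ := (lt_isLUB_iff ha).1
      (show (⟨ξ, hξ.trans a.2⟩ : Iio c.ord) < a from hξ)
    exact (hd hb ξ hξb).trans_le (ha.1 hb)
  -- As `g` strictly bounds `f` on `Iic ξ`, ordinals below the `n`-th iterate of `g` at `a` are sent
  -- by `f` below the next one.
  · let g : Ordinal.{u} → Ordinal.{u} := fun ξ => sSup ((· + 1) '' (f '' Iic ξ))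
    have hfg : ∀ ξ η, ξ ≤ η → f ξ < g η := fun ξ η h =>
      (lt_add_one _).trans_le (le_csSup Ordinal.bddAbove_of_small
        (mem_image_of_mem _ (mem_image_of_mem f h)))
    have hg : ∀ ξ < c.ord, g ξ < c.ord := fun ξ hξ => by
      refine Ordinal.sSup_add_one_lt_of_lt_cof (Cardinal.mk_image_le.trans_lt ?_) ?_
      · rw [← Ordinal.lift_cof, hc.cof_ord, ← Order.Iio_succ, Cardinal.mk_Iio_ordinal,
          Cardinal.lift_lt, ← Cardinal.lt_ord]
        exact (Cardinal.isSuccLimit_ord hc.aleph0_le).succ_lt hξ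
      · rintro _ ⟨η, hη, rfl⟩
        exact hf η (lt_of_le_of_lt hη hξ)
    have hn : Ordinal.nfp g a < c.ord :=
      Ordinal.nfp_lt_ord (by rwa [hc.cof_ord]) hg a.2
    refine ⟨⟨_, hn⟩, fun ξ hξ => ?_, Ordinal.le_nfp g a⟩
    obtain ⟨n, hn⟩ := Ordinal.lt_nfp_iff.1 hξ
    refine (hfg _ _ hn.le).trans_le ?_
    rw [← Function.iterate_succ_apply' g n]
    exact Ordinal.iterate_le_nfp g a (n + 1)

/-- A sequence of length `μ = cf α`, cofinal in `α`, each entry of which is chosen in a way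
depending on the set of the previous entries. -/
theorem exists_cofinal_sequence_of_step {μ : Cardinal.{u}} {α : Ordinal.{u}} (hα : α.cof = μ)
    (p : Set Ordinal.{u} → Ordinal.{u} → Prop)
    (hp : ∀ b ⊆ Iio α, #b < Cardinal.lift.{u + 1} μ → ∀ β < α, ∃ ξ < α, β ≤ ξ ∧ p b ξ) :
    ∃ s : Iio μ.ord → Ordinal.{u}, (∀ i, s i < α) ∧ (∀ β < α, ∃ i, β ≤ s i) ∧
      ∀ i, p (s '' Iio i) (s i) := by
  obtain ⟨A, hA, hAcard⟩ := Order.exists_cof_eq (Iio α)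
  have hAcard' : #(Iio μ.ord) = #A := by
    rw [hAcard, Ordinal.cof_Iio, ← Ordinal.lift_cof, hα, Cardinal.mk_Iio_ordinal,
      Cardinal.card_ord]
  obtain ⟨E⟩ := Cardinal.eq.1 hAcard'
  have hch : ∀ (b : Set Ordinal.{u}) (β : Ordinal.{u}), ∃ ξ, b ⊆ Iio α →
      #b < Cardinal.lift.{u + 1} μ → β < α → ξ < α ∧ β ≤ ξ ∧ p b ξ := fun b β => by
    by_cases h : b ⊆ Iio α ∧ #b < Cardinal.lift.{u + 1} μ ∧ β < α
    · obtain ⟨ξ, hξ⟩ := hp b h.1 h.2.1 β h.2.2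
      exact ⟨ξ, fun _ _ _ => hξ⟩
    · exact ⟨0, fun h1 h2 h3 => absurd ⟨h1, h2, h3⟩ h⟩
  choose ch hch using hch
  -- Each `s i` is chosen at least `E i`, where `E` enumerates a cofinal subset of `α`.
  let s : Iio μ.ord → Ordinal.{u} := WellFoundedLT.fix (motive := fun _ => Ordinal.{u})
    fun i ih => ch (range fun j : Iio i => ih j j.2) (E i).1
  have hs : ∀ i, s i = ch (s '' Iio i) (E i).1 := fun i => by
    rw [image_eq_range]
    exact WellFoundedLT.fix_eq _ i
  have hcard : ∀ i : Iio μ.ord, #(s '' Iio i) < Cardinal.lift.{u + 1} μ := fun i => by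
    refine Cardinal.mk_image_le.trans_lt ?_
    have h : #(Iio i) ≤ #(Iio (i : Ordinal.{u})) := Cardinal.mk_le_of_injective
      (f := fun j => ⟨j.1, j.2⟩) fun a b hab => Subtype.ext (Subtype.ext (congrArg (·.1) hab))
    refine h.trans_lt ?_
    rw [Cardinal.mk_Iio_ordinal, Cardinal.lift_lt, ← Cardinal.lt_ord]
    exact i.2
  have key : ∀ i, s i < α ∧ (E i : Ordinal.{u}) ≤ s i ∧ p (s '' Iio i) (s i) := by
    intro i
    induction i using WellFoundedLT.induction with
    | ind i ih =>
      have := hch (s '' Iio i) (E i).1 (by rintro _ ⟨j, hj, rfl⟩; exact (ih j hj).1) (hcard i)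
        (E i).1.2
      rwa [← hs] at this
  refine ⟨s, fun i => (key i).1, fun β hβ => ?_, fun i => (key i).2.2⟩
  obtain ⟨a, ha, hβa⟩ := hA ⟨β, hβ⟩
  refine ⟨E.symm ⟨a, ha⟩, le_trans ?_ (key _).2.1⟩
  simpa using! hβa

/-- If `λ` has cofinality `μ < κ < λ` and `u(κ, σ) < λ` for all cardinals `σ ∈ [κ, λ)`, then for
every `μ`-club `C` of `P_κ(λ⁺)`, almost all `α < λ⁺` of cofinality `μ` are of the form `sup x` for
some `x ∈ C`. -/
theorem exists_club_subset_sSup_image {μ κ lam : Cardinal.{u}} (hκ : κ.IsRegular)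
    (hμκ : μ < κ) (hκlam : κ < lam) (hcof : lam.ord.cof = μ)
    (hu : ∀ σ : Cardinal.{u}, κ ≤ σ → σ < lam → uNum κ σ < Cardinal.lift.{u + 1} lam)
    {C : Set (Set Ordinal.{u})} (hC : IsNuClub μ κ (succ lam) C) :
    ∃ D : Set (Iio (succ lam).ord), IsClub D ∧
      ∀ α ∈ D, (α : Ordinal.{u}) ∈ ECof μ (succ lam) → ∃ x ∈ C, sSup x = α := by
  have hlam : ℵ₀ ≤ lam := hκ.aleph0_le.trans hκlam.le
  have hreg : (succ lam).IsRegular := Cardinal.isRegular_succ hlam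
  have hlim : IsSuccLimit (succ lam).ord := Cardinal.isSuccLimit_ord hreg.aleph0_le
  have hlam1 : 0 < lam.ord := by simpa using zero_le.trans_lt hκlam
  obtain ⟨e, he, hecard, heb⟩ := exists_covering_sequence hκ hμκ hκlam hcof hu
  obtain ⟨x, hx⟩ := exists_coherent_sequence hκ hC.subset hC.cofinal e he hecard
  -- The first term strictly bounds the elements of `x ξ`; the second bounds the index of a set
  -- covering a small subset of `ξ`.
  let f : Ordinal.{u} → Ordinal.{u} := fun ξ =>
    max (sSup ((· + 1) '' x ξ)) (lam.ord * (ξ + 1))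
  have hf : ∀ ξ < (succ lam).ord, f ξ < (succ lam).ord := fun ξ hξ => by
    obtain ⟨hsub, hcard⟩ := hC.subset (hx ξ hξ).1
    refine max_lt (Ordinal.sSup_add_one_lt_of_lt_cof ?_ hsub) ?_
    · rw [← Ordinal.lift_cof, hreg.cof_ord]
      exact hcard.trans (Cardinal.lift_lt.2 (hκlam.trans (lt_succ lam)))
    · rw [Cardinal.lt_ord, Ordinal.card_mul, Cardinal.card_ord, Order.lt_succ_iff]
      exact Cardinal.mul_le_of_le hlam le_rfl
        (Order.lt_succ_iff.1 (Cardinal.lt_ord.1 (hlim.succ_lt hξ)))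
  have hxf : ∀ ξ < (succ lam).ord, x ξ ⊆ Iio (f ξ) := fun ξ hξ η hη => by
    refine (lt_add_one η).trans_le (le_max_of_le_left
      (le_csSup ⟨(succ lam).ord + 1, ?_⟩ (mem_image_of_mem _ hη)))
    rintro _ ⟨y, hy, rfl⟩
    exact add_le_add_left ((hC.subset (hx ξ hξ).1).1 hy).le 1
  refine ⟨_, isClub_closurePoints hreg (hlam.trans_lt (lt_succ lam)) hf, fun α hα hαE => ?_⟩
  obtain ⟨α, hαlt⟩ := α
  obtain ⟨-, hαlim, hαcof⟩ := hαE
  change ∀ ξ < α, f ξ < α at hα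
  change IsSuccLimit α at hαlim
  change α.cof = μ at hαcof
  change ∃ x ∈ C, sSup x = α
  obtain ⟨s, hsα, hscof, hs⟩ := exists_cofinal_sequence_of_step hαcof
    (fun b ξ => b ⊆ e ξ ∧ ∀ η ∈ b, f η ≤ ξ) (by
      intro b hb hbμ β hβ
      have hfb : ∀ η ∈ b, f η < sSup ((· + 1) '' (f '' b)) := fun η hη =>
        (lt_add_one _).trans_le (le_csSup ⟨α + 1, by
          rintro _ ⟨_, ⟨y, hy, rfl⟩, rfl⟩; exact add_le_add_left (hα y (hb hy)).le 1⟩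
          (mem_image_of_mem _ (mem_image_of_mem f hη)))
      let γ := max β (sSup ((· + 1) '' (f '' b)))
      have hγ : γ < α := max_lt hβ (Ordinal.sSup_add_one_lt_of_lt_cof
        (by rw [← Ordinal.lift_cof, hαcof]; exact Cardinal.mk_image_le.trans_lt hbμ)
        (by rintro _ ⟨y, hy, rfl⟩; exact hα y (hb hy)))
      have hfγ : ∀ η ∈ b, f η < γ := fun η hη => (hfb η hη).trans_le (le_max_right _ _)
      have hbγ : b ⊆ Iio γ := fun η hη => by
        refine lt_of_le_of_lt ?_ (hfγ η hη)
        exact ((lt_add_one η).le.trans (Ordinal.le_mul_right _ hlam1)).trans (le_max_right _ _)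
      obtain ⟨ξ, hγξ, hξ, hbξ⟩ := heb γ (hγ.trans hαlt) b hbγ hbμ
      exact ⟨ξ, (hξ.trans_le (le_max_right _ _)).trans (hα γ hγ), (le_max_left _ _).trans hγξ,
        hbξ, fun η hη => (hfγ η hη).le.trans hγξ⟩)
  have hsθ : ∀ i, s i < (succ lam).ord := fun i => (hsα i).trans hαlt
  refine ⟨⋃ i, x (s i), hC.closed (fun i => x (s i)) (fun j i hji => ?_)
    fun i => (hx _ (hsθ i)).1, ?_⟩
  · obtain ⟨h1, h2⟩ := hs i
    have hj : s j ∈ s '' Iio i := mem_image_of_mem s hji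
    -- Strictness: `s i ∈ x (s i)`, while `x (s j)` lies below `f (s j) ≤ s i`.
    refine ⟨(hx _ (hsθ i)).2.2 _ (h1 hj), fun h => ?_⟩
    exact ((hxf _ (hsθ j) (h (hx _ (hsθ i)).2.1)).trans_le (h2 _ hj)).false
  · refine csSup_eq_of_forall_le_of_forall_lt_exists_gt ?_ ?_ ?_
    · obtain ⟨i, -⟩ := hscof 0 hαlim.bot_lt
      exact ⟨s i, mem_iUnion.2 ⟨i, (hx _ (hsθ i)).2.1⟩⟩
    · intro η hη
      obtain ⟨i, hi⟩ := mem_iUnion.1 hη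
      exact ((hxf _ (hsθ i) hi).trans (hα _ (hsα i))).le
    · intro β hβ
      obtain ⟨i, hi⟩ := hscof _ (hαlim.succ_lt hβ)
      exact ⟨s i, mem_iUnion.2 ⟨i, (hx _ (hsθ i)).2.1⟩, (lt_succ β).trans_le hi⟩

theorem proposition4p9 (μ κ lam : Cardinal.{u}) (hμ : μ.IsRegular) (hκ : κ.IsRegular)
    (hμκ : μ < κ) (hκlam : κ < lam) (hcof : lam.ord.cof = μ)
    (hu : ∀ σ : Cardinal.{u}, κ ≤ σ → σ < lam → uNum κ σ < Cardinal.lift.{u + 1} lam) :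
    SupIdeal κ (Order.succ lam) (NNuS μ κ (Order.succ lam)) ⊆
      restrictTo (Iio (Order.succ lam).ord) (NSIdeal (Order.succ lam))
        (ECof μ (Order.succ lam)) := by
  rintro B ⟨hB, -, C, hC, hdisj⟩
  refine ⟨hB, inter_subset_left.trans hB, fun hstat => ?_⟩
  obtain ⟨D, hD, hDC⟩ := exists_club_subset_sSup_image hκ hμκ hκlam hcof hu hC
  obtain ⟨α, ⟨hαB, hαE⟩, hαD⟩ := hstat hD
  obtain ⟨x, hxC, hxα⟩ := hDC α hαD hαE
  refine (Set.ext_iff.1 hdisj x).1 ⟨⟨hC.subset hxC, ?_⟩, hxC⟩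
  change sSup x ∈ B
  rwa [hxα]
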